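/- **Proposition (bicontinuity of $(\Psi_d,\Phi_d)_{d\in\mathbb A}$).** All Banach spaces are complex. A *pseudolattice* $\mathscr X$ assigns to every Banach space $B$ a Banach space $\mathscr X(B)$ of sequences $(b_n)_{n\in\mathbb Z}$ in $B$ such that $\|b_m\|_B\le\|(b_n)\|_{\mathscr X(B)}$ for all $m$; such that $\mathscr X(A)$ is a closed subspace of $\mathscr X(B)$ whenever $A$ is a closed subspace of $B$; and such that, for a constant $C$ depending only on $\mathscr X$, every bounded operator $T:A\to B$ satisfies $\|(Ta_n)\|_{\mathscr X(B)}\le C\|T\|\,\|(a_n)\|_{\mathscr X(A)}$ for $(a_n)\in\mathscr X(A)$. A pair $\mathbf X=(\mathscr X_0,\mathscr X_1)$ of pseudolattices *admits differentiation* if for every Banach space $B$ and every $\rho\in\mathbb C$ with $0<|\rho|<1$: $(b_n)\in\mathscr X_0(B)$ implies $\big(\sum_{k\ge0}\rho^k b_{n-k}\big)_n\in\mathscr X_0(B)$, and $(b_n)\in\mathscr X_1(B)$ implies $\big(\sum_{k\ge0}\rho^k b_{n+k}\big)_n\in\mathscr X_1(B)$. Let $\mathbf X$ be a pair of pseudolattices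 admitting differentiation, and let $\overline B=(X_0,X_1)$ be an interpolation couple of Banach spaces, continuously embedded in their sum $\Sigma=X_0+X_1$, a Banach space. Let $$\mathscr J(\mathbf X,\overline B)=\{(b_n)_{n\in\mathbb Z}:\ b_n\in X_0\cap X_1,\ (e^{jn}b_n)\in\mathscr X_j(X_j),\ j=0,1\},\qquad \|(b_n)\|=\max_{j=0,1}\|(e^{jn}b_n)\|_{\mathscr X_j(X_j)}.$$ For $s\in\mathbb A=\{z\in\mathbb C:1<|z|<e\}$ let $\Phi_s,\Psi_s:\mathscr J(\mathbf X,\overline B)\to\Sigma$ be the bounded operators $$\Phi_s((b_n))=\sum_{n\in\mathbb Z}s^nb_n,\qquad \Psi_s((b_n))=\sum_{n\in\mathbb Z}ns^{n-1}b_n .$$ For subspaces $M,N$ of a Banach space put $g(M,N)=\max\{\sup_{x\in M,\|x\|=1}\operatorname{dist}(x,N),\ \sup_{y\in N,\|y\|=1}\operatorname{dist}(y,M)\}$, where the supremum of the empty set is $0$. Then the family $(\Psi_d,\Phi_d)_{d\in\mathbb A}$ is bicontinuous, that is, for every $s\in\mathbb A$, $$\lim_{t\to s}g(\ker\Phi_t,\ker\Phi_s)=0\quad\text{and}\quad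 \lim_{t\to s}g(\ker\Psi_t\cap\ker\Phi_t,\ \ker\Psi_s\cap\ker\Phi_s)=0 .$$ Moreover, for every compact $K\subset\mathbb A$ there is a constant $C$ such that $g(\ker\Phi_t,\ker\Phi_s)\le C|t-s|$ for all $s,t\in K$. -/

import Mathlib

open Filter Topology

universe u v

/-! ### Banach spaces of two-sided sequences and pseudolattices -/

/-- A Banach space of two-sided `B`-valued sequences `(b_n)_{n ∈ ℤ}` whose norm dominates
every coordinate: `‖b_m‖ ≤ ‖(b_n)‖`. -/
structure BanachSequenceSpace (B : Type u) [NormedAddCommGroup B] [NormedSpace ℂ B] where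
  /-- the sequences belonging to the space -/
  carrier : Submodule ℂ (ℤ → B)
  /-- the norm (it is definite because of `coord_le`) -/
  nrm : Seminorm ℂ carrier
  coord_le : ∀ (b : carrier) (m : ℤ), ‖(b : ℤ → B) m‖ ≤ nrm b
  complete : ∀ w : ℕ → carrier,
    (∀ ε > 0, ∃ N, ∀ m ≥ N, ∀ n ≥ N, nrm (w m - w n) < ε) →
      ∃ a : carrier, Tendsto (fun n => nrm (w n - a)) atTop (𝓝 0)

/-- A pseudolattice: a map `𝒳` assigning to each complex Banach space `B` a Banach space `𝒳(B)`
of two-sided `B`-valued sequences such that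
* `‖b_m‖_B ≤ ‖(b_n)‖_{𝒳(B)}` (this is `BanachSequenceSpace.coord_le`);
* if `A` is a closed subspace of `B`, then `𝒳(A)` is a closed subspace of `𝒳(B)`;
* bounded operators `T : A → B` act coordinatewise from `𝒳(A)` to `𝒳(B)` with norm at most
  `C ‖T‖`, where `C` depends only on `𝒳`. -/
structure Pseudolattice where
  space : ∀ (B : Type u) [NormedAddCommGroup B] [NormedSpace ℂ B] [CompleteSpace B],
    BanachSequenceSpace B
  /-- for a closed (that is, complete) subspace `A` of `B`, `𝒳(A)` is contained in `𝒳(B)` … -/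
  sub_mem : ∀ (B : Type u) [NormedAddCommGroup B] [NormedSpace ℂ B] [CompleteSpace B]
    (A : Submodule ℂ B) [CompleteSpace A], ∀ a ∈ (space A).carrier,
      (fun n => ((a n : A) : B)) ∈ (space B).carrier
  /-- … with the same norm … -/
  sub_nrm : ∀ (B : Type u) [NormedAddCommGroup B] [NormedSpace ℂ B] [CompleteSpace B]
    (A : Submodule ℂ B) [CompleteSpace A] (a : (space A).carrier),
      (space B).nrm ⟨fun n => (((a : ℤ → A) n : A) : B), sub_mem B A a a.2⟩ = (space A).nrm a
  /-- … and is closed in `𝒳(B)`. -/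
  sub_closed : ∀ (B : Type u) [NormedAddCommGroup B] [NormedSpace ℂ B] [CompleteSpace B]
    (A : Submodule ℂ B) [CompleteSpace A] (b : (space B).carrier),
      (∀ ε > 0, ∃ a : (space A).carrier,
        (space B).nrm (b - ⟨fun n => (((a : ℤ → A) n : A) : B), sub_mem B A a a.2⟩) < ε) →
      ∃ a ∈ (space A).carrier, (b : ℤ → B) = fun n => ((a n : A) : B)
  map_mem : ∀ (A B : Type u) [NormedAddCommGroup A] [NormedSpace ℂ A] [CompleteSpace A]
    [NormedAddCommGroup B] [NormedSpace ℂ B] [CompleteSpace B] (T : A →L[ℂ] B),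
      ∀ a ∈ (space A).carrier, (fun n => T (a n)) ∈ (space B).carrier
  map_bound : ∃ C : ℝ, 0 < C ∧
    ∀ (A B : Type u) [NormedAddCommGroup A] [NormedSpace ℂ A] [CompleteSpace A]
      [NormedAddCommGroup B] [NormedSpace ℂ B] [CompleteSpace B] (T : A →L[ℂ] B)
      (a : (space A).carrier),
      (space B).nrm ⟨fun n => T ((a : ℤ → A) n), map_mem A B T a a.2⟩
        ≤ C * ‖T‖ * (space A).nrm a

/-- The couple of pseudolattices `(𝒳₀, 𝒳₁)` admits differentiation: for every Banach space `B` and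
every `ρ ∈ ℂ` with `0 < |ρ| < 1`, the one-sided geometric averages
`(∑_{k ≥ 0} ρ^k b_{n-k})_n` of elements of `𝒳₀(B)` stay in `𝒳₀(B)`, and the averages
`(∑_{k ≥ 0} ρ^k b_{n+k})_n` of elements of `𝒳₁(B)` stay in `𝒳₁(B)`.
(The series converge absolutely in `B`, since the sequences are bounded.) -/
structure AdmitsDifferentiation (P Q : Pseudolattice.{u}) : Prop where
  left : ∀ (B : Type u) [NormedAddCommGroup B] [NormedSpace ℂ B] [CompleteSpace B] (ρ : ℂ),
    0 < ‖ρ‖ → ‖ρ‖ < 1 → ∀ b ∈ (P.space B).carrier,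
      (fun n : ℤ => ∑' k : ℕ, ρ ^ k • b (n - k)) ∈ (P.space B).carrier
  right : ∀ (B : Type u) [NormedAddCommGroup B] [NormedSpace ℂ B] [CompleteSpace B] (ρ : ℂ),
    0 < ‖ρ‖ → ‖ρ‖ < 1 → ∀ b ∈ (Q.space B).carrier,
      (fun n : ℤ => ∑' k : ℕ, ρ ^ k • b (n + k)) ∈ (Q.space B).carrier

/-! ### Interpolation couples and the space `𝒥(𝐗, B̄)` -/

/-- An interpolation couple: the Banach spaces `X₀`, `X₁` are continuously embedded in the Banach
space `S`, and `S` is their sum `X₀ + X₁`. -/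
structure InterpolationCouple (X₀ X₁ : Type u) (S : Type v)
    [NormedAddCommGroup X₀] [NormedSpace ℂ X₀] [NormedAddCommGroup X₁] [NormedSpace ℂ X₁]
    [NormedAddCommGroup S] [NormedSpace ℂ S] where
  i₀ : X₀ →L[ℂ] S
  i₁ : X₁ →L[ℂ] S
  inj₀ : Function.Injective i₀
  inj₁ : Function.Injective i₁
  sum_eq : ∀ x : S, ∃ (x₀ : X₀) (x₁ : X₁), x = i₀ x₀ + i₁ x₁

section JSpace

variable {X₀ X₁ : Type u} {S : Type v}
  [NormedAddCommGroup X₀] [NormedSpace ℂ X₀] [CompleteSpace X₀]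
  [NormedAddCommGroup X₁] [NormedSpace ℂ X₁] [CompleteSpace X₁]
  [NormedAddCommGroup S] [NormedSpace ℂ S]

/-- The sequence `(e^n y_n)_{n ∈ ℤ}`, as a linear function of `(y_n)`. -/
noncomputable def expTwist (X : Type u) [NormedAddCommGroup X] [NormedSpace ℂ X] :
    (ℤ → X) →ₗ[ℂ] (ℤ → X) where
  toFun y := fun n => ((Real.exp (n : ℝ) : ℝ) : ℂ) • y n
  map_add' y z := by funext n; simp
  map_smul' a y := by funext n; exact smul_comm _ _ _

/-- The sequences in `X₀ ∩ X₁` with `(b_n) ∈ 𝒳₀(X₀)` and `(e^n b_n) ∈ 𝒳₁(X₁)`. An element `b_n` of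
`X₀ ∩ X₁` is given by its two copies `x_n ∈ X₀`, `y_n ∈ X₁`, which coincide in `X₀ + X₁`. -/
noncomputable def jSubmodule (P Q : Pseudolattice.{u}) (c : InterpolationCouple X₀ X₁ S) :
    Submodule ℂ ((ℤ → X₀) × (ℤ → X₁)) where
  carrier := {b | (∀ n, c.i₀ (b.1 n) = c.i₁ (b.2 n)) ∧ b.1 ∈ (P.space X₀).carrier ∧
    expTwist X₁ b.2 ∈ (Q.space X₁).carrier}
  add_mem' := by
    rintro a b ⟨ha, ha0, ha1⟩ ⟨hb, hb0, hb1⟩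
    refine ⟨fun n => by simp [ha n, hb n], Submodule.add_mem _ ha0 hb0, ?_⟩
    rw [Prod.snd_add, map_add]
    exact Submodule.add_mem _ ha1 hb1
  zero_mem' := by
    refine ⟨fun n => by simp, Submodule.zero_mem _, ?_⟩
    rw [Prod.snd_zero, map_zero]
    exact Submodule.zero_mem _
  smul_mem' := by
    rintro r a ⟨ha, ha0, ha1⟩
    refine ⟨fun n => by simp [ha n], Submodule.smul_mem _ r ha0, ?_⟩
    rw [Prod.smul_snd, map_smul]
    exact Submodule.smul_mem _ r ha1

/-- The space `𝒥(𝐗, B̄)` for `𝐗 = (P, Q)` and `B̄ = (X₀, X₁)`. It is a type of its own, so that its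
only topology is the one of the norm below. -/
def JSpace (P Q : Pseudolattice.{u}) (c : InterpolationCouple X₀ X₁ S) : Type u :=
  jSubmodule P Q c

namespace JSpace

variable {P Q : Pseudolattice.{u}} {c : InterpolationCouple X₀ X₁ S}

noncomputable instance : AddCommGroup (JSpace P Q c) :=
  inferInstanceAs (AddCommGroup (jSubmodule P Q c))

noncomputable instance : Module ℂ (JSpace P Q c) :=
  inferInstanceAs (Module ℂ (jSubmodule P Q c))

/-- `b ↦ (b_n) ∈ 𝒳₀(X₀)` -/
noncomputable def toLeft : JSpace P Q c →ₗ[ℂ] (P.space X₀).carrier :=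
  LinearMap.codRestrict _ ((LinearMap.fst ℂ _ _).comp (jSubmodule P Q c).subtype) fun b => b.2.2.1

/-- `b ↦ (e^n b_n) ∈ 𝒳₁(X₁)` -/
noncomputable def toRight : JSpace P Q c →ₗ[ℂ] (Q.space X₁).carrier :=
  LinearMap.codRestrict _
    ((expTwist X₁).comp ((LinearMap.snd ℂ _ _).comp (jSubmodule P Q c).subtype)) fun b => b.2.2.2

/-- The `n`-th coefficient `b_n`, as an element of `X₀ + X₁`. -/
noncomputable def coeff (n : ℤ) : JSpace P Q c →ₗ[ℂ] S :=
  (c.i₀ : X₀ →ₗ[ℂ] S).comp ((LinearMap.proj n).comp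
    ((LinearMap.fst ℂ (ℤ → X₀) (ℤ → X₁)).comp (jSubmodule P Q c).subtype))

/-- The norm `max (‖(b_n)‖_{𝒳₀(X₀)}, ‖(e^n b_n)‖_{𝒳₁(X₁)})`. -/
noncomputable instance : Norm (JSpace P Q c) :=
  ⟨fun b => max ((P.space X₀).nrm (toLeft b)) ((Q.space X₁).nrm (toRight b))⟩

theorem norm_def (b : JSpace P Q c) :
    ‖b‖ = max ((P.space X₀).nrm (toLeft b)) ((Q.space X₁).nrm (toRight b)) := rfl

theorem norm_left_le (b : JSpace P Q c) (n : ℤ) : ‖b.1.1 n‖ ≤ ‖b‖ :=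
  ((P.space X₀).coord_le (toLeft b) n).trans (le_max_left _ _)

theorem norm_right_le (b : JSpace P Q c) (n : ℤ) : ‖b.1.2 n‖ ≤ Real.exp (-(n : ℝ)) * ‖b‖ := by
  have h : ‖((Real.exp (n : ℝ) : ℝ) : ℂ) • b.1.2 n‖ ≤ ‖b‖ :=
    ((Q.space X₁).coord_le (toRight b) n).trans (le_max_right _ _)
  rw [norm_smul, Complex.norm_real, Real.norm_of_nonneg (Real.exp_pos _).le] at h
  rw [Real.exp_neg, inv_mul_eq_div, le_div_iff₀ (Real.exp_pos _), mul_comm]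
  exact h

theorem core : NormedSpace.Core ℂ (JSpace P Q c) where
  norm_nonneg b := (norm_nonneg _).trans (norm_left_le b 0)
  norm_smul r b := by
    simp only [norm_def, map_smul, map_smul_eq_mul]
    exact (mul_max_of_nonneg _ _ (norm_nonneg r)).symm
  norm_triangle a b := by
    simp only [norm_def, map_add]
    refine max_le ?_ ?_
    · exact (map_add_le_add _ _ _).trans (add_le_add (le_max_left _ _) (le_max_left _ _))
    · exact (map_add_le_add _ _ _).trans (add_le_add (le_max_right _ _) (le_max_right _ _))
  norm_eq_zero_iff b := by
    refine ⟨fun h => ?_, ?_⟩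
    · refine Subtype.ext (Prod.ext (funext fun n => ?_) (funext fun n => ?_))
      · have := norm_left_le b n
        rw [h] at this
        exact norm_le_zero_iff.1 this
      · have := norm_right_le b n
        rw [h, mul_zero] at this
        exact norm_le_zero_iff.1 this
    · rintro rfl
      simp [norm_def]

noncomputable instance : NormedAddCommGroup (JSpace P Q c) := NormedAddCommGroup.ofCore core

noncomputable instance : NormedSpace ℂ (JSpace P Q c) := NormedSpace.ofCore core

theorem norm_coeff_le (b : JSpace P Q c) (n : ℤ) :
    ‖coeff n b‖ ≤ max ‖c.i₀‖ ‖c.i₁‖ * min 1 (Real.exp (-(n : ℝ))) * ‖b‖ := by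
  have h0 : ‖coeff n b‖ ≤ ‖c.i₀‖ * ‖b‖ :=
    (c.i₀.le_opNorm _).trans (mul_le_mul_of_nonneg_left (norm_left_le b n) (norm_nonneg _))
  have h1 : ‖coeff n b‖ ≤ ‖c.i₁‖ * (Real.exp (-(n : ℝ)) * ‖b‖) := by
    have h : coeff n b = c.i₁ (b.1.2 n) := b.2.1 n
    rw [h]
    exact (c.i₁.le_opNorm _).trans (mul_le_mul_of_nonneg_left (norm_right_le b n) (norm_nonneg _))
  rcases min_cases 1 (Real.exp (-(n : ℝ))) with ⟨h, -⟩ | ⟨h, -⟩ <;> rw [h]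
  · rw [mul_one]
    exact h0.trans (mul_le_mul_of_nonneg_right (le_max_left _ _) (norm_nonneg _))
  · rw [mul_assoc]
    exact h1.trans (mul_le_mul_of_nonneg_right (le_max_right _ _) (by positivity))

end JSpace

end JSpace

/-! ### The annulus and the interpolators -/

/-- The open annulus `𝔸 = {z : 1 < |z| < e}`. -/
def annulus : Set ℂ := {z | 1 < ‖z‖ ∧ ‖z‖ < Real.exp 1}

/-- A weight `w` for which `∑ w_n b_n` converges absolutely for every `b ∈ 𝒥(𝐗, B̄)`. -/
def LaurentSummable (w : ℤ → ℂ) : Prop :=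
  Summable fun n : ℤ => ‖w n‖ * min 1 (Real.exp (-(n : ℝ)))

theorem laurentSummable_aux (z : annulus) :
    Summable fun n : ℤ => (1 + |(n : ℝ)|) * ‖(z : ℂ)‖ ^ n * min 1 (Real.exp (-(n : ℝ))) := by
  obtain ⟨z, h1, h2⟩ := z
  have h0 : 0 < ‖z‖ := one_pos.trans h1
  have key : ∀ r : ℝ, 0 ≤ r → r < 1 → Summable fun n : ℕ => (1 + (n : ℝ)) * r ^ n := by
    intro r hr0 hr1
    have a := summable_geometric_of_lt_one hr0 hr1
    have b := summable_pow_mul_geometric_of_norm_lt_one 1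
      (show ‖r‖ < 1 by rwa [Real.norm_of_nonneg hr0])
    refine (a.add b).congr fun n => ?_
    ring
  refine Summable.of_nat_of_neg ?_ ?_
  · refine Summable.of_nonneg_of_le (fun n => by positivity) (fun n => ?_)
      (key (‖z‖ / Real.exp 1) (by positivity) ((div_lt_one (Real.exp_pos _)).2 h2))
    have : Real.exp (-(((n : ℕ) : ℤ) : ℝ)) = (Real.exp 1 ^ n)⁻¹ := by
      rw [Real.exp_neg, ← Real.exp_nat_mul]; simp
    rw [div_pow, div_eq_mul_inv, ← mul_assoc, ← this]
    simp only [Int.cast_natCast, zpow_natCast, Nat.abs_cast]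
    gcongr
    exact min_le_right _ _
  · refine Summable.of_nonneg_of_le (fun n => by positivity) (fun n => ?_)
      (key (‖z‖⁻¹) (by positivity) (inv_lt_one_of_one_lt₀ h1))
    simp only [Int.cast_neg, Int.cast_natCast, abs_neg, Nat.abs_cast, zpow_neg, zpow_natCast,
      inv_pow]
    exact mul_le_of_le_one_right (by positivity) (min_le_left _ _)

theorem laurentSummable_eval (z : annulus) : LaurentSummable fun n => (z : ℂ) ^ n := by
  have hz : 0 < ‖(z : ℂ)‖ := one_pos.trans z.2.1
  refine Summable.of_nonneg_of_le (fun n => by positivity) (fun n => ?_) (laurentSummable_aux z)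
  rw [norm_zpow]
  gcongr
  exact le_mul_of_one_le_left (by positivity) (by linarith [abs_nonneg (n : ℝ)])

theorem laurentSummable_deriv (z : annulus) :
    LaurentSummable fun n => (n : ℂ) * (z : ℂ) ^ (n - 1) := by
  have hz : 0 < ‖(z : ℂ)‖ := one_pos.trans z.2.1
  refine Summable.of_nonneg_of_le (fun n => by positivity) (fun n => ?_) (laurentSummable_aux z)
  rw [norm_mul, norm_zpow, Complex.norm_intCast]
  gcongr
  · linarith
  · exact z.2.1.le
  · linarith

section Interpolators

variable {X₀ X₁ : Type u} {S : Type v}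
  [NormedAddCommGroup X₀] [NormedSpace ℂ X₀] [CompleteSpace X₀]
  [NormedAddCommGroup X₁] [NormedSpace ℂ X₁] [CompleteSpace X₁]
  [NormedAddCommGroup S] [NormedSpace ℂ S]

theorem LaurentSummable.summable_norm {w : ℤ → ℂ} (hw : LaurentSummable w)
    {P Q : Pseudolattice.{u}} {c : InterpolationCouple X₀ X₁ S} (b : JSpace P Q c) :
    Summable fun n => ‖w n • JSpace.coeff n b‖ := by
  refine Summable.of_nonneg_of_le (fun n => norm_nonneg _) (fun n => ?_)
    (hw.mul_right (max ‖c.i₀‖ ‖c.i₁‖ * ‖b‖))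
  rw [norm_smul]
  calc ‖w n‖ * ‖JSpace.coeff n b‖
      ≤ ‖w n‖ * (max ‖c.i₀‖ ‖c.i₁‖ * min 1 (Real.exp (-(n : ℝ))) * ‖b‖) :=
        mul_le_mul_of_nonneg_left (JSpace.norm_coeff_le b n) (norm_nonneg _)
    _ = _ := by ring

variable [CompleteSpace S]

/-- Laurent compatibility: for `b ∈ 𝒥(𝐗, B̄)` and `z ∈ 𝔸`, the Laurent series `∑ z^n b_n`
converges in `X₀ + X₁`. -/
theorem laurent_compatible {P Q : Pseudolattice.{u}} {c : InterpolationCouple X₀ X₁ S}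
    (b : JSpace P Q c) (z : annulus) : Summable fun n : ℤ => (z : ℂ) ^ n • JSpace.coeff n b :=
  ((laurentSummable_eval z).summable_norm b).of_norm

/-- The bounded operator `(b_n) ↦ ∑_{n ∈ ℤ} w_n b_n` from `𝒥(𝐗, B̄)` to `X₀ + X₁`. -/
noncomputable def laurentSum (P Q : Pseudolattice.{u}) (c : InterpolationCouple X₀ X₁ S)
    (w : ℤ → ℂ) (hw : LaurentSummable w) : JSpace P Q c →L[ℂ] S :=
  LinearMap.mkContinuous
    { toFun := fun b => ∑' n : ℤ, w n • JSpace.coeff n b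
      map_add' := fun a b => by
        simp only [map_add, smul_add]
        exact (hw.summable_norm a).of_norm.tsum_add (hw.summable_norm b).of_norm
      map_smul' := fun r b => by
        simp only [map_smul, RingHom.id_apply]
        rw [← (hw.summable_norm b).of_norm.tsum_const_smul r]
        exact tsum_congr fun n => smul_comm _ _ _ }
    ((∑' n : ℤ, ‖w n‖ * min 1 (Real.exp (-(n : ℝ)))) * max ‖c.i₀‖ ‖c.i₁‖)
    (fun b => by
      refine (norm_tsum_le_tsum_norm (hw.summable_norm b)).trans ?_
      rw [mul_assoc, ← tsum_mul_right]
      refine (hw.summable_norm b).tsum_le_tsum (fun n => ?_) (hw.mul_right _)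
      rw [norm_smul]
      calc ‖w n‖ * ‖JSpace.coeff n b‖
          ≤ ‖w n‖ * (max ‖c.i₀‖ ‖c.i₁‖ * min 1 (Real.exp (-(n : ℝ))) * ‖b‖) :=
            mul_le_mul_of_nonneg_left (JSpace.norm_coeff_le b n) (norm_nonneg _)
        _ = _ := by ring)

/-- `Φ_s (b_n) = ∑ s^n b_n`. -/
noncomputable def evalInterpolator (P Q : Pseudolattice.{u}) (c : InterpolationCouple X₀ X₁ S)
    (s : annulus) : JSpace P Q c →L[ℂ] S :=
  laurentSum P Q c (fun n => (s : ℂ) ^ n) (laurentSummable_eval s)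

/-- `Ψ_s (b_n) = ∑ n s^{n-1} b_n`. -/
noncomputable def derivInterpolator (P Q : Pseudolattice.{u}) (c : InterpolationCouple X₀ X₁ S)
    (s : annulus) : JSpace P Q c →L[ℂ] S :=
  laurentSum P Q c (fun n => (n : ℂ) * (s : ℂ) ^ (n - 1)) (laurentSummable_deriv s)

end Interpolators

/-! ### The gap and bicontinuous families -/

/-- The gap `g(M, N) = max (sup_{x ∈ S_M} dist(x, N), sup_{y ∈ S_N} dist(y, M))`, where `S_M` is
the unit sphere of `M`. (The suprema are over sets bounded by `1`, and are `0` if `S_M = ∅`.) -/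
noncomputable def gap {H : Type*} [NormedAddCommGroup H] [NormedSpace ℂ H]
    (M N : Submodule ℂ H) : ℝ :=
  max (sSup ((fun x => Metric.infDist x (N : Set H)) '' {x | x ∈ M ∧ ‖x‖ = 1}))
    (sSup ((fun y => Metric.infDist y (M : Set H)) '' {y | y ∈ N ∧ ‖y‖ = 1}))

/-- A family `(Φ_d)_{d ∈ D}` on `H` is continuous if `g(ker Φ_t, ker Φ_s) → 0` as `t → s`. -/
def IsContinuousFamily {D H S : Type*} [TopologicalSpace D]
    [NormedAddCommGroup H] [NormedSpace ℂ H] [NormedAddCommGroup S] [NormedSpace ℂ S]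
    (Φ : D → H →L[ℂ] S) : Prop :=
  ∀ s : D, Tendsto (fun t => gap (LinearMap.ker (Φ t : H →ₗ[ℂ] S))
    (LinearMap.ker (Φ s : H →ₗ[ℂ] S))) (𝓝 s) (𝓝 0)

/-- A family of pairs `(Ψ_d, Φ_d)_{d ∈ D}` is bicontinuous if `(Φ_d)` is continuous and
`g(ker Ψ_t ∩ ker Φ_t, ker Ψ_s ∩ ker Φ_s) → 0` as `t → s`. -/
def IsBicontinuousFamily {D H S : Type*} [TopologicalSpace D]
    [NormedAddCommGroup H] [NormedSpace ℂ H] [NormedAddCommGroup S] [NormedSpace ℂ S]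
    (Ψ Φ : D → H →L[ℂ] S) : Prop :=
  IsContinuousFamily Φ ∧
  ∀ s : D, Tendsto (fun t =>
    gap (LinearMap.ker (Ψ t : H →ₗ[ℂ] S) ⊓ LinearMap.ker (Φ t : H →ₗ[ℂ] S))
      (LinearMap.ker (Ψ s : H →ₗ[ℂ] S) ⊓ LinearMap.ker (Φ s : H →ₗ[ℂ] S))) (𝓝 s) (𝓝 0)

/-!
An element `f = (b_n)` of `𝒥(𝐗, B̄)` is treated as the Laurent series `f(z) = ∑ z^n b_n` on the
annulus, so that `Φ_s f = f(s)` and `Ψ_s f = f'(s)`. Everything rests on division by `z - s`.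

If `f(s) = 0`, then `f(z) = (z - s) g(z)` with `g` in `𝒥(𝐗, B̄)` again: expanding `1 / (z - s)` in
powers of `z / s`, or in powers of `s / z`, gives two formulas for the coefficients of `g`, which
agree because `f(s) = 0`; the first shows that `g` is controlled in `𝒳₀(X₀)`, the second that it is
controlled in `𝒳₁(X₁)`, since the couple admits differentiation
(`JSpace.exists_isLaurentQuotient`). The quotient is unique, and `𝒥(𝐗, B̄)` is complete, so by the
closed graph theorem `‖g‖ ≤ M ‖f‖` (`JSpace.exists_quotientBound`). This bound is locally uniform
in `s`: if `f = (z - t) g`, then `f + (t - s) g = (z - s) g`, whence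
`‖g‖ ≤ M ‖f‖ + M |t - s| ‖g‖`, and the last term can be absorbed (`JSpace.QuotientBound.of_near`).

The gaps are estimated by moving the zero. If `f = (z - s) g`, then `(z - t) g = f + (s - t) g` is
an element of `ker Φ_t` at distance at most `M |t - s| ‖f‖` from `f`. If `f` has a double zero at
`s`, then `f = (z - s) g` and `g = (z - s) h`, and `(z - t)² h = f + 2 (s - t) g + (s - t)² h` is an
element of `ker Ψ_t ∩ ker Φ_t` close to `f`.
-/

/-! ### The gap -/

theorem gap_nonneg {H : Type*} [NormedAddCommGroup H] [NormedSpace ℂ H] (M N : Submodule ℂ H) :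
    0 ≤ gap M N := by
  refine le_max_of_le_left (Real.sSup_nonneg ?_)
  rintro _ ⟨x, -, rfl⟩
  exact Metric.infDist_nonneg

theorem gap_le {H : Type*} [NormedAddCommGroup H] [NormedSpace ℂ H] {M N : Submodule ℂ H} {r : ℝ}
    (hr : 0 ≤ r) (hM : ∀ x ∈ M, ‖x‖ = 1 → ∃ y ∈ N, ‖x - y‖ ≤ r)
    (hN : ∀ y ∈ N, ‖y‖ = 1 → ∃ x ∈ M, ‖y - x‖ ≤ r) : gap M N ≤ r := by
  refine max_le (Real.sSup_le ?_ hr) (Real.sSup_le ?_ hr)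
  · rintro _ ⟨x, ⟨hx, hx1⟩, rfl⟩
    obtain ⟨y, hy, hxy⟩ := hM x hx hx1
    exact (Metric.infDist_le_dist_of_mem hy).trans (by rwa [dist_eq_norm])
  · rintro _ ⟨x, ⟨hx, hx1⟩, rfl⟩
    obtain ⟨y, hy, hxy⟩ := hN x hx hx1
    exact (Metric.infDist_le_dist_of_mem hy).trans (by rwa [dist_eq_norm])

/-! ### Series over the integers -/

theorem summable_int_sub_one {E : Type*} [AddCommGroup E] [TopologicalSpace E] {F : ℤ → E}
    (hF : Summable F) : Summable fun n => F (n - 1) :=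
  (Equiv.subRight (1 : ℤ)).summable_iff (f := F) |>.2 hF

theorem tsum_int_sub_one {E : Type*} [AddCommGroup E] [TopologicalSpace E] (F : ℤ → E) :
    ∑' n, F (n - 1) = ∑' n, F n :=
  (Equiv.subRight (1 : ℤ)).tsum_eq F

/-- A vanishing Laurent series `∑ z^m b_m = 0`, multiplied by `z^{-n}` and cut at the index `n`,
which is contained in both parts. -/
theorem tsum_shift_add_tsum_shift_neg {E : Type*} [NormedAddCommGroup E] [NormedSpace ℂ E]
    [CompleteSpace E] {z : ℂ} (hz : z ≠ 0) {b : ℤ → E} (hb : Summable fun m : ℤ => z ^ m • b m)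
    (h0 : ∑' m : ℤ, z ^ m • b m = 0) (n : ℤ) :
    ∑' k : ℕ, z ^ k • b (n + k) + ∑' k : ℕ, z⁻¹ ^ k • b (n - k) = b n := by
  have hn := zpow_ne_zero n hz
  have hterm : ∀ m : ℤ, (z ^ n)⁻¹ • z ^ (n + m) • b (n + m) = z ^ m • b (n + m) := fun m => by
    rw [zpow_add₀ hz, mul_smul, inv_smul_smul₀ hn]
  have hshift : Summable fun m : ℤ => z ^ (n + m) • b (n + m) :=
    (Equiv.addLeft n).summable_iff (f := fun m : ℤ => z ^ m • b m) |>.2 hb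
  have hsum : Summable fun m : ℤ => z ^ m • b (n + m) :=
    (hshift.const_smul (z ^ n)⁻¹).congr hterm
  have hzero : ∑' m : ℤ, z ^ m • b (n + m) = 0 := by
    have h1 : ∑' m : ℤ, z ^ (n + m) • b (n + m) = 0 :=
      ((Equiv.addLeft n).tsum_eq fun m : ℤ => z ^ m • b m).trans h0
    rw [← tsum_congr hterm, hshift.tsum_const_smul, h1, smul_zero]
  have hsplit := Summable.tsum_of_nat_of_neg (f := fun m : ℤ => z ^ m • b (n + m))
    (hsum.comp_injective Nat.cast_injective)
    (hsum.comp_injective (neg_injective.comp Nat.cast_injective))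
  rw [hzero] at hsplit
  simp only [zpow_zero, one_smul, add_zero, zpow_natCast, zpow_neg, ← sub_eq_add_neg,
    ← inv_pow] at hsplit
  exact sub_eq_zero.1 hsplit.symm

namespace JSpace

variable {X₀ X₁ : Type u} {S : Type v}
  [NormedAddCommGroup X₀] [NormedSpace ℂ X₀] [CompleteSpace X₀]
  [NormedAddCommGroup X₁] [NormedSpace ℂ X₁] [CompleteSpace X₁]
  [NormedAddCommGroup S] [NormedSpace ℂ S]
  {P Q : Pseudolattice.{u}} {c : InterpolationCouple X₀ X₁ S}

/-! ### Coefficients and completeness of `𝒥(𝐗, B̄)` -/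

theorem coeff_eq_left (b : JSpace P Q c) (n : ℤ) : coeff n b = c.i₀ (b.1.1 n) := rfl

theorem coeff_eq_right (b : JSpace P Q c) (n : ℤ) : coeff n b = c.i₁ (b.1.2 n) := b.2.1 n

theorem ext_coeff {a b : JSpace P Q c} (h : ∀ n, coeff n a = coeff n b) : a = b := by
  refine Subtype.ext (Prod.ext (funext fun n => c.inj₀ ?_) (funext fun n => c.inj₁ ?_))
  · exact h n
  · rw [← coeff_eq_right, ← coeff_eq_right, h n]

theorem norm_coeff_le_const (b : JSpace P Q c) (n : ℤ) :
    ‖coeff n b‖ ≤ max ‖c.i₀‖ ‖c.i₁‖ * ‖b‖ := by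
  refine (norm_coeff_le b n).trans ?_
  gcongr
  exact mul_le_of_le_one_right (le_max_of_le_left (norm_nonneg _)) (min_le_left _ _)

theorem continuous_coeff (n : ℤ) : Continuous (coeff n : JSpace P Q c →ₗ[ℂ] S) :=
  AddMonoidHomClass.continuous_of_bound _ _ fun b => norm_coeff_le_const b n

theorem tendsto_coord {B : Type u} [NormedAddCommGroup B] [NormedSpace ℂ B]
    (E : BanachSequenceSpace B) {w : ℕ → E.carrier} {a : E.carrier}
    (h : Tendsto (fun k => E.nrm (w k - a)) atTop (𝓝 0)) (n : ℤ) :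
    Tendsto (fun k => (w k : ℤ → B) n) atTop (𝓝 ((a : ℤ → B) n)) := by
  rw [tendsto_iff_norm_sub_tendsto_zero]
  exact squeeze_zero (fun _ => norm_nonneg _) (fun k => E.coord_le (w k - a) n) h

instance : CompleteSpace (JSpace P Q c) := by
  refine Metric.complete_of_cauchySeq_tendsto fun u hu => ?_
  have hu' : ∀ ε > 0, ∃ N, ∀ m ≥ N, ∀ n ≥ N, ‖u m - u n‖ < ε := by
    simpa only [dist_eq_norm] using Metric.cauchySeq_iff.1 hu
  obtain ⟨a, ha⟩ := (P.space X₀).complete (fun k => toLeft (u k)) fun ε hε => by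
    obtain ⟨N, hN⟩ := hu' ε hε
    refine ⟨N, fun m hm n hn => lt_of_le_of_lt ?_ (hN m hm n hn)⟩
    rw [← map_sub]
    exact le_max_left _ _
  obtain ⟨a', ha'⟩ := (Q.space X₁).complete (fun k => toRight (u k)) fun ε hε => by
    obtain ⟨N, hN⟩ := hu' ε hε
    refine ⟨N, fun m hm n hn => lt_of_le_of_lt ?_ (hN m hm n hn)⟩
    rw [← map_sub]
    exact le_max_right _ _
  have hexp : ∀ n : ℤ, ((Real.exp (n : ℝ) : ℝ) : ℂ) ≠ 0 := fun n =>
    Complex.ofReal_ne_zero.2 (Real.exp_pos _).ne'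
  let y : ℤ → X₁ := fun n => ((Real.exp (n : ℝ) : ℝ) : ℂ)⁻¹ • (a' : ℤ → X₁) n
  have hy : expTwist X₁ y = a' := by
    funext n
    exact smul_inv_smul₀ (hexp n) _
  have hc : ∀ n, c.i₀ ((a : ℤ → X₀) n) = c.i₁ (y n) := fun n => by
    have h0 : Tendsto (fun k => c.i₀ ((u k).1.1 n)) atTop (𝓝 (c.i₀ ((a : ℤ → X₀) n))) :=
      (c.i₀.continuous.tendsto _).comp (tendsto_coord _ ha n)
    have h1 : Tendsto (fun k => c.i₁ ((u k).1.2 n)) atTop (𝓝 (c.i₁ (y n))) := by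
      refine (c.i₁.continuous.tendsto _).comp
        (((tendsto_coord _ ha' n).const_smul ((Real.exp (n : ℝ) : ℝ) : ℂ)⁻¹).congr fun k => ?_)
      exact inv_smul_smul₀ (hexp n) _
    exact tendsto_nhds_unique h0 (h1.congr fun k => ((u k).2.1 n).symm)
  let b : JSpace P Q c := ⟨(a, y), hc, a.2, by rw [hy]; exact a'.2⟩
  have hbl : toLeft b = a := rfl
  have hbr : toRight b = a' := Subtype.ext hy
  refine ⟨b, tendsto_iff_norm_sub_tendsto_zero.2 ?_⟩
  simpa only [norm_def, map_sub, hbl, hbr, max_self] using ha.max ha'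

/-! ### Division by `z - s` -/

/-- `f(z) = (z - s) g(z)` as Laurent series, expressed through the coefficients. -/
def IsLaurentQuotient (s : ℂ) (f g : JSpace P Q c) : Prop :=
  ∀ n : ℤ, coeff n f = coeff (n - 1) g - s • coeff n g

namespace IsLaurentQuotient

variable {s t : ℂ} {f f' g g' : JSpace P Q c}

theorem add (h : IsLaurentQuotient s f g) (h' : IsLaurentQuotient s f' g') :
    IsLaurentQuotient s (f + f') (g + g') := fun n => by
  simp only [map_add, h n, h' n, smul_add]
  abel

theorem smul (h : IsLaurentQuotient s f g) (a : ℂ) : IsLaurentQuotient s (a • f) (a • g) :=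
  fun n => by simp only [map_smul, h n, smul_sub, smul_comm s a]

theorem sub (h : IsLaurentQuotient s f g) (h' : IsLaurentQuotient s f' g') :
    IsLaurentQuotient s (f - f') (g - g') := by
  simpa [sub_eq_add_neg] using h.add (h'.smul (-1))

/-- Moving the zero from `s` to `t`: if `f = (z - s) g`, then `f + (s - t) g = (z - t) g`. -/
theorem move (h : IsLaurentQuotient s f g) (t : ℂ) :
    IsLaurentQuotient t (f + (s - t) • g) g := fun n => by
  rw [map_add, map_smul, h n, sub_smul]
  abel

/-- Only `0` is a quotient of `0`: from `g_{n-k} = s^k g_n` and `|s| > 1`, a nonzero coefficient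
would make the coefficients of `g` unbounded. -/
theorem eq_zero (hs : 1 < ‖s‖) (h : IsLaurentQuotient s (0 : JSpace P Q c) g) : g = 0 := by
  have step : ∀ n, coeff (n - 1) g = s • coeff n g := fun n => by
    have := h n
    rw [map_zero] at this
    exact sub_eq_zero.1 this.symm
  refine ext_coeff fun n => ?_
  have pow : ∀ k : ℕ, coeff (n - k) g = s ^ k • coeff n g := fun k => by
    induction k with
    | zero => simp
    | succ k ih =>
      rw [pow_succ', mul_smul, ← ih, ← step]
      congr 1
      push_cast
      ring_nf
  rw [map_zero]
  by_contra hne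
  have hpos : 0 < ‖coeff n g‖ := norm_pos_iff.2 hne
  obtain ⟨k, hk⟩ := pow_unbounded_of_one_lt (max ‖c.i₀‖ ‖c.i₁‖ * ‖g‖ / ‖coeff n g‖) hs
  rw [div_lt_iff₀ hpos, ← norm_pow, ← norm_smul, ← pow k] at hk
  exact absurd (norm_coeff_le_const g _) hk.not_ge

theorem unique (hs : 1 < ‖s‖) (h : IsLaurentQuotient s f g) (h' : IsLaurentQuotient s f g') :
    g = g' := by
  have := h.sub h'
  rw [sub_self] at this
  exact sub_eq_zero.1 (this.eq_zero hs)

end IsLaurentQuotient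

variable (P Q c) in
/-- Division by `z - s` in `𝒥(𝐗, B̄)` has norm at most `M`. -/
def QuotientBound (s : ℂ) (M : ℝ) : Prop :=
  ∀ f g : JSpace P Q c, IsLaurentQuotient s f g → ‖g‖ ≤ M * ‖f‖

theorem QuotientBound.mono {s : ℂ} {M M' : ℝ} (h : QuotientBound P Q c s M) (hM : M ≤ M') :
    QuotientBound P Q c s M' := fun f g hfg =>
  (h f g hfg).trans (mul_le_mul_of_nonneg_right hM (norm_nonneg _))

theorem QuotientBound.of_near {s t : ℂ} {M : ℝ} (hM : 0 < M) (h : QuotientBound P Q c s M)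
    (hst : ‖t - s‖ * M ≤ 1 / 2) : QuotientBound P Q c t (2 * M) := fun f g hfg => by
  have h1 := h _ _ (hfg.move s)
  have h2 : ‖f + (t - s) • g‖ ≤ ‖f‖ + ‖t - s‖ * ‖g‖ :=
    (norm_add_le _ _).trans (by rw [norm_smul])
  have h3 := mul_le_mul_of_nonneg_left h2 hM.le
  have h4 := mul_le_mul_of_nonneg_right hst (norm_nonneg g)
  linarith

variable [CompleteSpace S]

theorem evalInterpolator_apply (s : annulus) (b : JSpace P Q c) :
    evalInterpolator P Q c s b = ∑' n : ℤ, (s : ℂ) ^ n • coeff n b := rfl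

theorem derivInterpolator_apply (s : annulus) (b : JSpace P Q c) :
    derivInterpolator P Q c s b = ∑' n : ℤ, ((n : ℂ) * (s : ℂ) ^ (n - 1)) • coeff n b := rfl

theorem annulus_ne_zero (s : annulus) : (s : ℂ) ≠ 0 :=
  norm_pos_iff.1 (one_pos.trans s.2.1)

theorem IsLaurentQuotient.eval_eq_zero {s : annulus} {f g : JSpace P Q c}
    (h : IsLaurentQuotient (s : ℂ) f g) : evalInterpolator P Q c s f = 0 := by
  have hs := annulus_ne_zero s
  set F : ℤ → S := fun n => ((s : ℂ) * (s : ℂ) ^ n) • coeff n g with hF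
  have hsum : Summable F := by
    simpa only [hF, mul_smul] using (laurent_compatible g s).const_smul (s : ℂ)
  have hsum' : Summable fun n => F (n - 1) := summable_int_sub_one hsum
  have : ∀ n : ℤ, (s : ℂ) ^ n • coeff n f = F (n - 1) - F n := fun n => by
    have e : (s : ℂ) * (s : ℂ) ^ (n - 1) = (s : ℂ) ^ n := by
      rw [← zpow_one_add₀ hs, add_sub_cancel]
    simp only [hF, h n, smul_sub, smul_smul, e, mul_comm ((s : ℂ) ^ n)]
  rw [evalInterpolator_apply, tsum_congr this, hsum'.tsum_sub hsum,
    tsum_int_sub_one, sub_self]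

/-- If `f = (z - s) g`, then `f'(s) = g(s)`. -/
theorem IsLaurentQuotient.deriv_eq {s : annulus} {f g : JSpace P Q c}
    (h : IsLaurentQuotient (s : ℂ) f g) :
    derivInterpolator P Q c s f = evalInterpolator P Q c s g := by
  have hs := annulus_ne_zero s
  set F : ℤ → S := fun n => ((s : ℂ) * ((n : ℂ) * (s : ℂ) ^ (n - 1))) • coeff n g with hF
  set G : ℤ → S := fun n => (s : ℂ) ^ n • coeff n g with hG
  have hsumF : Summable F := by
    simpa only [hF, mul_smul] using
      ((laurentSummable_deriv s).summable_norm g).of_norm.const_smul (s : ℂ)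
  have hsumG : Summable G := laurent_compatible g s
  have hsum' : Summable fun n => (F + G) (n - 1) :=
    summable_int_sub_one (hsumF.add hsumG)
  have : ∀ n : ℤ, ((n : ℂ) * (s : ℂ) ^ (n - 1)) • coeff n f = (F + G) (n - 1) - F n :=
    fun n => by
      have e : (s : ℂ) ^ (n - 1) = s * (s : ℂ) ^ (n - 1 - 1) := by
        rw [← zpow_one_add₀ hs]
        congr 1
        ring
      simp only [hF, hG, h n, smul_sub, smul_smul, Pi.add_apply, ← add_smul]
      congr 2
      · rw [e]
        push_cast
        ring
      · ring
  rw [derivInterpolator_apply, tsum_congr this, hsum'.tsum_sub hsumF,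
    tsum_int_sub_one (F + G), evalInterpolator_apply]
  simp only [Pi.add_apply]
  rw [hsumF.tsum_add hsumG, add_sub_cancel_left]

/-- The elements of `ker Φ_s` are divisible by `z - s` in `𝒥(𝐗, B̄)`. The coefficients `g_n` of the
quotient are `-∑_{k ≥ 0} s^{-k-1} b_{n-k}`, and also `∑_{k ≥ 1} s^{k-1} b_{n+k}`. -/
theorem exists_isLaurentQuotient (hPQ : AdmitsDifferentiation P Q) {s : annulus}
    {f : JSpace P Q c} (hf : evalInterpolator P Q c s f = 0) :
    ∃ g, IsLaurentQuotient (s : ℂ) f g := by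
  have hs := annulus_ne_zero s
  have hs1 : 1 < ‖(s : ℂ)‖ := s.2.1
  have he : ((Real.exp 1 : ℝ) : ℂ) ≠ 0 := Complex.ofReal_ne_zero.2 (Real.exp_pos _).ne'
  have hexp : ∀ n : ℤ, ((Real.exp (n : ℝ) : ℝ) : ℂ) = ((Real.exp 1 : ℝ) : ℂ) ^ n := fun n => by
    push_cast
    rw [← Complex.exp_int_mul, mul_one]
  have hρ : ‖(s : ℂ)⁻¹‖ < 1 := by
    rw [norm_inv]
    exact inv_lt_one_of_one_lt₀ hs1
  have hσn : ‖(s : ℂ) / (Real.exp 1 : ℝ)‖ = ‖(s : ℂ)‖ / Real.exp 1 := by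
    rw [norm_div, Complex.norm_real, Real.norm_of_nonneg (Real.exp_pos _).le]
  have hσ : ‖(s : ℂ) / (Real.exp 1 : ℝ)‖ < 1 := by
    rw [hσn]
    exact (div_lt_one (Real.exp_pos _)).2 s.2.2
  set w : ℤ → X₁ := expTwist X₁ f.1.2
  have hwn : ∀ n, w n = ((Real.exp 1 : ℝ) : ℂ) ^ n • f.1.2 n := fun n => by
    rw [← hexp]
    rfl
  set L : ℤ → X₀ := fun n => ∑' k : ℕ, (s : ℂ)⁻¹ ^ k • f.1.1 (n - k) with hL
  set R : ℤ → X₁ := fun n => ∑' k : ℕ, ((s : ℂ) / (Real.exp 1 : ℝ)) ^ k • w (n + k) with hR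
  have hLmem : L ∈ (P.space X₀).carrier :=
    hPQ.left X₀ _ (norm_pos_iff.2 (inv_ne_zero hs)) hρ _ f.2.2.1
  have hRmem : R ∈ (Q.space X₁).carrier :=
    hPQ.right X₁ _ (norm_pos_iff.2 (div_ne_zero hs he)) hσ _ f.2.2.2
  have hLsum : ∀ n, Summable fun k : ℕ => (s : ℂ)⁻¹ ^ k • f.1.1 (n - k) := fun n => by
    refine Summable.of_norm_bounded
      ((summable_geometric_of_lt_one (norm_nonneg _) hρ).mul_right ‖f‖) fun k => ?_
    rw [norm_smul, norm_pow]
    exact mul_le_mul_of_nonneg_left (norm_left_le f _) (by positivity)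
  have hRsum : ∀ n, Summable fun k : ℕ => ((s : ℂ) / (Real.exp 1 : ℝ)) ^ k • w (n + k) :=
    fun n => by
      refine Summable.of_norm_bounded
        ((summable_geometric_of_lt_one (norm_nonneg _) hσ).mul_right ‖f‖) fun k => ?_
      rw [norm_smul, norm_pow]
      exact mul_le_mul_of_nonneg_left
        (((Q.space X₁).coord_le (toRight f) _).trans (le_max_right _ _)) (by positivity)
  have hLstep : ∀ n, L n = f.1.1 n + (s : ℂ)⁻¹ • L (n - 1) := fun n => by
    simp only [hL]
    rw [(hLsum n).tsum_eq_zero_add, ← (hLsum (n - 1)).tsum_const_smul]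
    congr 1
    · simp
    · refine tsum_congr fun k => ?_
      rw [smul_smul, ← pow_succ']
      congr 2
      push_cast
      ring_nf
  -- The coefficients of the quotient are `-s⁻¹ L_n` in `X₀` and `y_n` in `X₁`. The sum `R_n` starts
  -- at `k = 0`; its term `w_n` is subtracted, which makes `(e^n y_n)` a combination of `R` and `w`
  -- and avoids a shift, under which `𝒳₁(X₁)` need not be invariant.
  let y : ℤ → X₁ := fun n =>
    (((Real.exp 1 : ℝ) : ℂ) ^ n)⁻¹ • (s : ℂ)⁻¹ • (R n - w n)
  have hy : expTwist X₁ y = (s : ℂ)⁻¹ • (R - w) := by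
    funext n
    change ((Real.exp (n : ℝ) : ℝ) : ℂ) • y n = _
    rw [hexp]
    exact smul_inv_smul₀ (zpow_ne_zero n he) _
  have hcompat : ∀ n, c.i₀ ((-(s : ℂ)⁻¹) • L n) = c.i₁ (y n) := fun n => by
    have hpos : c.i₁ ((((Real.exp 1 : ℝ) : ℂ) ^ n)⁻¹ • R n) =
        ∑' k : ℕ, (s : ℂ) ^ k • coeff (n + k) f := by
      simp only [hR]
      rw [← (hRsum n).tsum_const_smul, c.i₁.map_tsum ((hRsum n).const_smul _)]
      refine tsum_congr fun k => ?_
      rw [hwn, coeff_eq_right, ← map_smul, smul_smul, smul_smul, zpow_add₀ he, zpow_natCast,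
        div_pow]
      congr 2
      have := zpow_ne_zero n he
      field_simp
    have hneg : c.i₀ (L n) =
        ∑' k : ℕ, (s : ℂ)⁻¹ ^ k • coeff (n - k) f := by
      simp only [hL]
      rw [c.i₀.map_tsum (hLsum n)]
      exact tsum_congr fun k => map_smul _ _ _
    have hsplit := tsum_shift_add_tsum_shift_neg hs (laurent_compatible f s) hf n
    rw [← hpos, ← hneg] at hsplit
    have hwn' : (((Real.exp 1 : ℝ) : ℂ) ^ n)⁻¹ • w n = f.1.2 n := by
      rw [hwn, inv_smul_smul₀ (zpow_ne_zero n he)]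
    have key : c.i₁ ((((Real.exp 1 : ℝ) : ℂ) ^ n)⁻¹ • (R n - w n)) = -c.i₀ (L n) := by
      rw [smul_sub, hwn', map_sub, ← coeff_eq_right, ← hsplit]
      abel
    simp only [y]
    rw [smul_comm, map_smul, map_smul, key, neg_smul, smul_neg]
  refine ⟨⟨((-(s : ℂ)⁻¹) • L, y), hcompat, Submodule.smul_mem _ _ hLmem, ?_⟩, fun n => ?_⟩
  · rw [hy]
    exact Submodule.smul_mem _ _ (Submodule.sub_mem _ hRmem f.2.2.2)
  · change c.i₀ (f.1.1 n) =
      c.i₀ ((-(s : ℂ)⁻¹) • L (n - 1)) - (s : ℂ) • c.i₀ ((-(s : ℂ)⁻¹) • L n)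
    rw [← map_smul, ← map_sub]
    congr 1
    rw [smul_smul, mul_neg, mul_inv_cancel₀ hs, neg_one_smul, sub_neg_eq_add, hLstep n, neg_smul]
    abel

/-! ### Locally uniform bounds for the quotient -/

theorem exists_quotientBound (hPQ : AdmitsDifferentiation P Q) (s : annulus) :
    ∃ M > 0, QuotientBound P Q c s M := by
  have hs : 1 < ‖(s : ℂ)‖ := s.2.1
  let K : Submodule ℂ (JSpace P Q c) := (evalInterpolator P Q c s).ker
  have hK : IsClosed (K : Set (JSpace P Q c)) := (evalInterpolator P Q c s).isClosed_ker
  have : CompleteSpace K := hK.completeSpace_coe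
  choose q hq using fun f : K => exists_isLaurentQuotient hPQ (s := s) f.2
  let D : K →ₗ[ℂ] JSpace P Q c :=
    { toFun := q
      map_add' := fun a b => (hq (a + b)).unique hs ((hq a).add (hq b))
      map_smul' := fun r a => (hq (r • a)).unique hs ((hq a).smul r) }
  -- The graph is closed: the relation between the coefficients of `f` and `g` passes to limits.
  have hD : Continuous D := by
    refine D.continuous_of_seq_closed_graph fun u f g hu hg => ?_
    refine IsLaurentQuotient.unique hs (fun n => ?_) (hq f)
    have hf := ((continuous_coeff n).comp continuous_subtype_val).tendsto f |>.comp hu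
    have hg' := (((continuous_coeff (n - 1)).tendsto g).comp hg).sub
      ((((continuous_coeff n).tendsto g).comp hg).const_smul (s : ℂ))
    exact tendsto_nhds_unique (hf.congr fun k => hq (u k) n) hg'
  obtain ⟨M, hM, hb⟩ := (⟨D, hD⟩ : K →L[ℂ] JSpace P Q c).bound
  refine ⟨M, hM, fun f g h => ?_⟩
  let f' : K := ⟨f, h.eval_eq_zero⟩
  rw [h.unique hs (hq f')]
  exact hb f'

theorem exists_eventually_quotientBound (hPQ : AdmitsDifferentiation P Q) (s : annulus) :
    ∃ M > 0, ∀ᶠ t : annulus in 𝓝 s, QuotientBound P Q c t M := by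
  obtain ⟨M, hM, h⟩ := exists_quotientBound (c := c) hPQ s
  refine ⟨2 * M, by positivity, ?_⟩
  have hlim : Tendsto (fun t : annulus => ‖(t : ℂ) - s‖ * M) (𝓝 s) (𝓝 0) := by
    have : Continuous fun t : annulus => ‖(t : ℂ) - s‖ * M := by fun_prop
    simpa using this.tendsto s
  filter_upwards [hlim.eventually (Iic_mem_nhds (by norm_num : (0 : ℝ) < 1 / 2))] with t ht
  exact h.of_near hM ht

theorem exists_quotientBound_of_isCompact (hPQ : AdmitsDifferentiation P Q) {K : Set annulus}
    (hK : IsCompact K) : ∃ M, ∀ s ∈ K, QuotientBound P Q c s M := by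
  refine hK.induction_on (p := fun K => ∃ M, ∀ s ∈ K, QuotientBound P Q c s M) ⟨0, by simp⟩
    (fun A B hAB ⟨M, hM⟩ => ⟨M, fun s hs => hM s (hAB hs)⟩) ?_ ?_
  · rintro A B ⟨M, hM⟩ ⟨N, hN⟩
    refine ⟨max M N, fun s hs => ?_⟩
    exact hs.elim (fun h => (hM s h).mono (le_max_left _ _))
      fun h => (hN s h).mono (le_max_right _ _)
  · intro s _
    obtain ⟨M, -, hM⟩ := exists_eventually_quotientBound (c := c) hPQ s
    exact ⟨_, mem_nhdsWithin_of_mem_nhds hM, M, fun t ht => ht⟩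

/-! ### Estimates of the gaps -/

theorem exists_mem_ker_eval_near (hPQ : AdmitsDifferentiation P Q) {s : annulus} {M : ℝ}
    (h : QuotientBound P Q c s M) (t : annulus) {f : JSpace P Q c}
    (hf : evalInterpolator P Q c s f = 0) (hf1 : ‖f‖ = 1) :
    ∃ f', evalInterpolator P Q c t f' = 0 ∧ ‖f - f'‖ ≤ M * ‖(t : ℂ) - s‖ := by
  obtain ⟨g, hg⟩ := exists_isLaurentQuotient hPQ hf
  refine ⟨_, (hg.move t).eval_eq_zero, ?_⟩
  have hgM := h f g hg
  rw [hf1, mul_one] at hgM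
  rw [sub_add_cancel_left, norm_neg, norm_smul, norm_sub_rev, mul_comm]
  exact mul_le_mul_of_nonneg_right hgM (norm_nonneg _)

theorem exists_mem_ker_deriv_inf_ker_eval_near (hPQ : AdmitsDifferentiation P Q) {s : annulus}
    {M : ℝ} (hM : 0 ≤ M) (h : QuotientBound P Q c s M) (t : annulus) {f : JSpace P Q c}
    (hf : evalInterpolator P Q c s f = 0) (hf' : derivInterpolator P Q c s f = 0)
    (hf1 : ‖f‖ = 1) :
    ∃ f', derivInterpolator P Q c t f' = 0 ∧ evalInterpolator P Q c t f' = 0 ∧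
      ‖f - f'‖ ≤ 2 * (M * ‖(t : ℂ) - s‖) + (M * ‖(t : ℂ) - s‖) ^ 2 := by
  obtain ⟨g, hg⟩ := exists_isLaurentQuotient hPQ hf
  rw [hg.deriv_eq] at hf'
  obtain ⟨k, hk⟩ := exists_isLaurentQuotient hPQ hf'
  have hgM := h f g hg
  rw [hf1, mul_one] at hgM
  have hkM : ‖k‖ ≤ M * M := (h g k hk).trans (mul_le_mul_of_nonneg_left hgM hM)
  -- With `k' = (z - t) k`, the element `f'` is `(z - t) k'`.
  set k' := g + ((s : ℂ) - t) • k with hk'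
  have h1 : IsLaurentQuotient (t : ℂ) k' k := hk.move t
  have h2 : IsLaurentQuotient (t : ℂ) (f + ((s : ℂ) - t) • g + ((s : ℂ) - t) • k') k' :=
    (hg.move t).add (h1.smul _)
  refine ⟨_, ?_, h2.eval_eq_zero, ?_⟩
  · rw [h2.deriv_eq, h1.eval_eq_zero]
  · have e : f - (f + ((s : ℂ) - t) • g + ((s : ℂ) - t) • k') =
        (2 * ((t : ℂ) - s)) • g - ((t : ℂ) - s) ^ 2 • k := by
      rw [hk']
      module
    rw [e]
    refine (norm_sub_le _ _).trans ?_
    rw [norm_smul, norm_smul, norm_mul, norm_pow, Complex.norm_ofNat]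
    have := norm_nonneg ((t : ℂ) - s)
    calc 2 * ‖(t : ℂ) - s‖ * ‖g‖ + ‖(t : ℂ) - s‖ ^ 2 * ‖k‖
        ≤ 2 * ‖(t : ℂ) - s‖ * M + ‖(t : ℂ) - s‖ ^ 2 * (M * M) := by gcongr
      _ = _ := by ring

theorem gap_ker_eval_le (hPQ : AdmitsDifferentiation P Q) {s t : annulus} {M : ℝ} (hM : 0 ≤ M)
    (hs : QuotientBound P Q c s M) (ht : QuotientBound P Q c t M) :
    gap (LinearMap.ker (evalInterpolator P Q c t : JSpace P Q c →ₗ[ℂ] S))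
      (LinearMap.ker (evalInterpolator P Q c s : JSpace P Q c →ₗ[ℂ] S)) ≤
        M * ‖(t : ℂ) - s‖ := by
  refine gap_le (by positivity) (fun f hf hf1 => ?_) fun f hf hf1 => ?_
  · rw [norm_sub_rev]
    exact exists_mem_ker_eval_near hPQ ht s hf hf1
  · exact exists_mem_ker_eval_near hPQ hs t hf hf1

theorem gap_ker_deriv_inf_ker_eval_le (hPQ : AdmitsDifferentiation P Q) {s t : annulus} {M : ℝ}
    (hM : 0 ≤ M) (hs : QuotientBound P Q c s M) (ht : QuotientBound P Q c t M) :
    gap (LinearMap.ker (derivInterpolator P Q c t : JSpace P Q c →ₗ[ℂ] S) ⊓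
        LinearMap.ker (evalInterpolator P Q c t : JSpace P Q c →ₗ[ℂ] S))
      (LinearMap.ker (derivInterpolator P Q c s : JSpace P Q c →ₗ[ℂ] S) ⊓
        LinearMap.ker (evalInterpolator P Q c s : JSpace P Q c →ₗ[ℂ] S)) ≤
        2 * (M * ‖(t : ℂ) - s‖) + (M * ‖(t : ℂ) - s‖) ^ 2 := by
  refine gap_le (by positivity) (fun f hf hf1 => ?_) fun f hf hf1 => ?_
  · obtain ⟨f', h1, h2, h3⟩ :=
      exists_mem_ker_deriv_inf_ker_eval_near hPQ hM ht s hf.2 hf.1 hf1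
    exact ⟨f', ⟨h1, h2⟩, by rwa [norm_sub_rev (t : ℂ)]⟩
  · obtain ⟨f', h1, h2, h3⟩ :=
      exists_mem_ker_deriv_inf_ker_eval_near hPQ hM hs t hf.2 hf.1 hf1
    exact ⟨f', ⟨h1, h2⟩, h3⟩

end JSpace

theorem mainTheorem7 {X₀ X₁ : Type u} {S : Type v}
    [NormedAddCommGroup X₀] [NormedSpace ℂ X₀] [CompleteSpace X₀]
    [NormedAddCommGroup X₁] [NormedSpace ℂ X₁] [CompleteSpace X₁]
    [NormedAddCommGroup S] [NormedSpace ℂ S] [CompleteSpace S]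
    (P Q : Pseudolattice.{u}) (hPQ : AdmitsDifferentiation P Q)
    (c : InterpolationCouple X₀ X₁ S) :
    IsBicontinuousFamily (derivInterpolator P Q c) (evalInterpolator P Q c) ∧
    ∀ K : Set annulus, IsCompact K → ∃ C : ℝ, ∀ s ∈ K, ∀ t ∈ K,
      gap (LinearMap.ker (evalInterpolator P Q c t : JSpace P Q c →ₗ[ℂ] S))
        (LinearMap.ker (evalInterpolator P Q c s : JSpace P Q c →ₗ[ℂ] S)) ≤
          C * ‖(t : ℂ) - (s : ℂ)‖ := by 
  refine ⟨⟨fun s => ?_, fun s => ?_⟩, fun K hK => ?_⟩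
  · obtain ⟨M, hM, h⟩ := JSpace.exists_eventually_quotientBound (c := c) hPQ s
    have hcont : Continuous fun t : annulus => M * ‖(t : ℂ) - s‖ := by fun_prop
    refine squeeze_zero' (Eventually.of_forall fun t => gap_nonneg _ _)
      (h.mono fun t ht => JSpace.gap_ker_eval_le hPQ hM.le h.self_of_nhds ht) ?_
    simpa using hcont.tendsto s
  · obtain ⟨M, hM, h⟩ := JSpace.exists_eventually_quotientBound (c := c) hPQ s
    have hcont : Continuous fun t : annulus =>
        2 * (M * ‖(t : ℂ) - s‖) + (M * ‖(t : ℂ) - s‖) ^ 2 := by fun_prop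
    refine squeeze_zero' (Eventually.of_forall fun t => gap_nonneg _ _)
      (h.mono fun t ht =>
        JSpace.gap_ker_deriv_inf_ker_eval_le hPQ hM.le h.self_of_nhds ht) ?_
    simpa using hcont.tendsto s
  · obtain ⟨M, h⟩ := JSpace.exists_quotientBound_of_isCompact (c := c) hPQ hK
    have h' := fun s hs => (h s hs).mono (le_max_left M 0)
    exact ⟨max M 0, fun s hs t ht =>
      JSpace.gap_ker_eval_le hPQ (le_max_right _ _) (h' s hs) (h' t ht)⟩
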